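/- Let $n\in\mathbb N$, $p\ge 2$, let $\Omega\subset\mathbb R^n$ be open, $0<T<\infty$ and $\Omega_T=\Omega\times(0,T)$. For $z_0=(x_0,t_0)\in\mathbb R^{n}\times\mathbb R$ and $r,\theta>0$ let $$Q_{r,\theta}(z_0)=B(x_0,r)\times\big(t_0-\theta^{2-p}r^p,\;t_0+\theta^{2-p}r^p\big),$$ and for $\sigma\ge 0$, $\alpha>0$ and $E\subset\mathbb R^{n+1}$ let $$\mathcal H^{\sigma}_{(\alpha)}(E)=\lim_{\delta\downarrow 0}\ \inf\Big\{\sum_{i}r_i^{\sigma}:\ E\subset\bigcup_{i}Q_{r_i,r_i^{\alpha}}(z_i),\ 0<r_i<\delta\Big\},$$ where the infimum is over at most countable families of cylinders. Write $A\Subset B$ if the closure of $A$ is compact and contained in $B$. Corollary. Let $\sigma\ge 0$ and $\alpha>0$, and let $E\Subset\Omega_T$ be a Borel set with $\mathcal H^{\sigma}_{(\alpha)}(E)>0$. Then there exists a (nonnegative) Radon measure $\mu\not\equiv 0$ on $\mathbb R^{n+1}$ with $\operatorname{supp}\mu\Subset E$ such that $$\mu\big(Q_{r,r^{\alpha}}(z_0)\big)\le(2r)^{\sigma}\qquad\text{for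 all } z_0\in\mathbb R^{n+1}\text{ and } r>0.$$ -/

import Mathlib

noncomputable section

/-- Space-time `ℝⁿ × ℝ`, with points `z = (x, t)`; the space variable carries the Euclidean norm. -/
abbrev SpaceTime (n : ℕ) : Type := EuclideanSpace ℝ (Fin n) × ℝ

/-- The space-time cylinder `Ω_T = Ω × (0, T)`. -/
def spaceTimeCylinder {n : ℕ} (Ω : Set (EuclideanSpace ℝ (Fin n))) (T : ℝ) :
    Set (SpaceTime n) :=
  Ω ×ˢ Set.Ioo 0 T

/-- The intrinsic cylinder
`Q_{r,θ}(x₀, t₀) = B(x₀, r) × (t₀ - θ^(2-p) r^p, t₀ + θ^(2-p) r^p)`, for `r, θ > 0`. -/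
def intrinsicCylinder {n : ℕ} (p r θ : ℝ) (z₀ : SpaceTime n) : Set (SpaceTime n) :=
  Metric.ball z₀.1 r ×ˢ Set.Ioo (z₀.2 - θ ^ (2 - p) * r ^ p) (z₀.2 + θ ^ (2 - p) * r ^ p)

/-- `A ⋐ B`: the closure of `A` is compact and contained in `B`. -/
def CompactlyContained {X : Type*} [TopologicalSpace X] (A B : Set X) : Prop :=
  IsCompact (closure A) ∧ closure A ⊆ B

/-- The infimum of `∑ i, r_i ^ σ` over all at most countable covers of `E` by cylinders
`Q_{r_i, r_i^α}(z_i)` with `0 < r_i < δ`. The family is indexed by an arbitrary set `I` of natural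
numbers, so that finite families (and, for `E = ∅`, the empty one) are admitted. -/
def parabolicHausdorffPre {n : ℕ} (p α σ δ : ℝ) (E : Set (SpaceTime n)) : ENNReal :=
  ⨅ (I : Set ℕ) (z : ℕ → SpaceTime n) (r : ℕ → ℝ)
    (_ : ∀ i ∈ I, 0 < r i ∧ r i < δ)
    (_ : E ⊆ ⋃ i ∈ I, intrinsicCylinder p (r i) ((r i) ^ α) (z i)),
    ∑' i : I, ENNReal.ofReal ((r i) ^ σ)

/-- The intrinsic parabolic Hausdorff measure `𝓗^σ_(α)(E)`. The limit as `δ ↓ 0` is written as a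
supremum; see `tendsto_parabolicHausdorffPre`. -/
def parabolicHausdorff {n : ℕ} (p α σ : ℝ) (E : Set (SpaceTime n)) : ENNReal :=
  ⨆ (δ : ℝ) (_ : 0 < δ), parabolicHausdorffPre p α σ δ E

theorem parabolicHausdorffPre_antitone {n : ℕ} (p α σ : ℝ) (E : Set (SpaceTime n)) :
    Antitone fun δ : ℝ => parabolicHausdorffPre p α σ δ E := by
  intro δ δ' h
  refine le_iInf fun I => le_iInf fun z => le_iInf fun r => le_iInf fun hr => le_iInf fun hE => ?_
  exact iInf_le_of_le I <| iInf_le_of_le z <| iInf_le_of_le r <|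
    iInf_le_of_le (fun i hi => ⟨(hr i hi).1, (hr i hi).2.trans_le h⟩) <| iInf_le_of_le hE le_rfl

theorem tendsto_parabolicHausdorffPre {n : ℕ} (p α σ : ℝ) (E : Set (SpaceTime n)) :
    Filter.Tendsto (fun δ : ℝ => parabolicHausdorffPre p α σ δ E) (nhdsWithin 0 (Set.Ioi 0))
      (nhds (parabolicHausdorff p α σ E)) := by
  refine tendsto_order.2 ⟨fun a ha => ?_, fun a ha => ?_⟩
  · obtain ⟨δ, hδ, hlt⟩ : ∃ δ : ℝ, 0 < δ ∧ a < parabolicHausdorffPre p α σ δ E := by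
      simpa [parabolicHausdorff, lt_iSup_iff] using ha
    filter_upwards [Ioo_mem_nhdsGT hδ] with x hx
    exact hlt.trans_le (parabolicHausdorffPre_antitone p α σ E hx.2.le)
  · filter_upwards [self_mem_nhdsWithin] with x hx
    exact lt_of_le_of_lt (le_iSup₂_of_le (f := fun (δ : ℝ) (_ : 0 < δ) =>
      parabolicHausdorffPre p α σ δ E) x hx le_rfl) ha

end

/-!
The theorem is a Frostman lemma for Borel sets. Write `β = p + α (2 - p)`; the cylinder
`Q_{r, r^α}(z)` has spatial radius `r` and half-height `r ^ β` in time, where `β` may have any sign.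

The cylinders are compared with a nested sequence of partitions of space-time into dyadic boxes
(`dyadicCode`), with side `2⁻ᵏ` in space and about `min (1, 2^(-k β))` in time. A box lies in a
cylinder of comparable radius (`mem_intrinsicCylinder_of_dyadicCode_eq`), and within a bounded set a
cylinder of radius `r` is covered by boundedly many boxes of side at most `2 r`
(`exists_level_finset_dyadicCode`). Hence `E` has positive net content, that is, positive infimum of
the costs of its covers by boxes of small size (`parabolicHausdorffPre_le_netContent`).

Nestedness gives the net content two properties. It is continuous along increasing sequences of
arbitrary sets (`IsNestedNet.netContent_iUnion_le`), because passing to maximal boxes makes it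
strongly subadditive; and fractional covers by boxes cost no less than the net content
(`IsNestedNet.netContent_le_of_weights`), because a fractional cover is an average of covers.

By the first property and the capacitability argument for analytic sets, there is a compact
`K ⊆ E` each of whose neighbourhoods contains a subset of `E` of net content bounded below
(`exists_isCompact_of_analyticSet`). A fractional cover of `K` by finitely many cylinders, being
open, is a fractional cover of a neighbourhood of `K`, so by the second property its cost is bounded
below by a positive constant. Finally, the Hahn-Banach and Riesz-Markov-Kakutani theorems turn this
lower bound into a nonzero measure on `K` which does not exceed the cost on any cylinder
(`exists_measure_le_of_fractionalCost`).
-/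

open MeasureTheory Set Filter Topology
open scoped ENNReal NNReal

/-! ### Covers by the cells of a nested sequence of partitions -/

section NetContent

variable {X Y : Type*}

/-- A sequence of partitions of `X`, the `k`-th one given by the fibres of `b k`, is nested if each
partition refines the earlier ones. The pair `(k, v)` encodes the cell `{x | b k x = v}`. -/
def IsNestedNet (b : ℕ → X → Y) : Prop :=
  ∀ ⦃l k : ℕ⦄, l ≤ k → ∀ ⦃x y : X⦄, b k x = b k y → b l x = b l y

/-- The union of the cells with codes in `F`. -/
def cellUnion (b : ℕ → X → Y) (F : Set (ℕ × Y)) : Set X := {x | ∃ k, (k, b k x) ∈ F}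

/-- The total cost of a family of cells, a cell of the `k`-th partition costing `τ k`. -/
noncomputable def cellCost (τ : ℕ → ℝ≥0∞) (F : Set (ℕ × Y)) : ℝ≥0∞ :=
  ∑' q, F.indicator (fun q => τ q.1) q

/-- The net content of `A`: the infimum of the total costs of families of cells covering
`A`. A family may be uncountable, but then its cost is infinite if the costs `τ k` are positive. -/
noncomputable def netContent (b : ℕ → X → Y) (τ : ℕ → ℝ≥0∞) (A : Set X) : ℝ≥0∞ :=
  ⨅ (F : Set (ℕ × Y)) (_ : A ⊆ cellUnion b F), cellCost τ F

/-- The cell `q` meets the cell `q'` of a coarser partition; for nested partitions this says that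
`q` is nonempty and contained in `q'`. -/
def IsBelow (b : ℕ → X → Y) (q q' : ℕ × Y) : Prop :=
  q'.1 < q.1 ∧ ∃ x, b q.1 x = q.2 ∧ b q'.1 x = q'.2

/-- The cells of `F` that are not contained in a coarser cell of `F`. -/
def maximalCells (b : ℕ → X → Y) (F : Set (ℕ × Y)) : Set (ℕ × Y) :=
  {q ∈ F | ∀ q' ∈ F, ¬ IsBelow b q q'}

variable {b : ℕ → X → Y} {τ : ℕ → ℝ≥0∞} {A : Set X} {F G : Set (ℕ × Y)}

theorem netContent_le (h : A ⊆ cellUnion b F) : netContent b τ A ≤ cellCost τ F :=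
  iInf₂_le F h

theorem cellUnion_mono (h : F ⊆ G) : cellUnion b F ⊆ cellUnion b G :=
  fun _ ⟨k, hk⟩ => ⟨k, h hk⟩

theorem IsNestedNet.eq_of_isBelow (hb : IsNestedNet b) {q q' : ℕ × Y} (h : IsBelow b q q') {x : X}
    (hx : b q.1 x = q.2) : b q'.1 x = q'.2 := by
  obtain ⟨hlt, y, hy, hy'⟩ := h
  rw [← hy', hb hlt.le (hx.trans hy.symm)]

theorem IsNestedNet.cellUnion_maximalCells (hb : IsNestedNet b) (F : Set (ℕ × Y)) :
    cellUnion b (maximalCells b F) = cellUnion b F := by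
  classical
  refine (cellUnion_mono fun q hq => hq.1).antisymm fun x hx => ?_
  -- The coarsest cell of `F` containing `x` is maximal.
  refine ⟨Nat.find hx, Nat.find_spec hx, fun q' hq' h => ?_⟩
  refine Nat.find_min hx h.1 ?_
  rwa [hb.eq_of_isBelow h rfl]

/-- Splitting the union of two families into its maximal cells and the remaining ones, the latter
still cover every point covered by both families. This is a strong subadditivity property. -/
theorem cellCost_maximalCells_add_le (hF : A ⊆ cellUnion b F)
    (hG : A ⊆ cellUnion b G) :
    cellCost τ (maximalCells b (F ∪ G)) + netContent b τ A ≤ cellCost τ F + cellCost τ G := by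
  classical
  set W := maximalCells b (F ∪ G)
  have hcov : A ⊆ cellUnion b ((F ∩ G) ∪ ((F ∪ G) \ W)) := by
    intro x hx
    obtain ⟨k, hk⟩ := hF hx
    obtain ⟨l, hl⟩ := hG hx
    rcases lt_trichotomy k l with h | rfl | h
    · exact ⟨l, Or.inr ⟨Or.inr hl, fun hW => hW.2 _ (Or.inl hk) ⟨h, x, rfl, rfl⟩⟩⟩
    · exact ⟨k, Or.inl ⟨hk, hl⟩⟩
    · exact ⟨k, Or.inr ⟨Or.inl hk, fun hW => hW.2 _ (Or.inr hl) ⟨h, x, rfl, rfl⟩⟩⟩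
  refine (add_le_add le_rfl (netContent_le hcov)).trans ?_
  unfold cellCost
  rw [← ENNReal.tsum_add, ← ENNReal.tsum_add]
  refine ENNReal.tsum_le_tsum fun q => ?_
  have hWFG : q ∈ W → q ∈ F ∪ G := fun h => h.1
  by_cases hF : q ∈ F <;> by_cases hG : q ∈ G <;> by_cases hW : q ∈ W <;>
    simp_all [indicator]

theorem cellCost_le_of_eventually {W : Set (ℕ × Y)} {V : ℕ → Set (ℕ × Y)} {c : ℝ≥0∞}
    (h : ∀ q ∈ W, ∀ᶠ i in atTop, q ∈ V i) (hc : ∀ i, cellCost τ (V i) ≤ c) :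
    cellCost τ W ≤ c := by
  classical
  rw [cellCost, ENNReal.tsum_eq_iSup_sum]
  refine iSup_le fun s => ?_
  have : ∀ᶠ i in atTop, ∀ q ∈ s, q ∈ W → q ∈ V i := by
    rw [Filter.eventually_all_finset]
    intro q _
    by_cases hq : q ∈ W
    · simpa [hq] using h q hq
    · simp [hq]
  obtain ⟨i, hi⟩ := this.exists
  refine le_trans ?_ (hc i)
  refine le_trans (Finset.sum_le_sum fun q hq => ?_) (ENNReal.sum_le_tsum s)
  by_cases hW : q ∈ W
  · simp [hW, hi q hq hW]
  · simp [hW]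

/-- Increasing sets lemma: the net content is continuous along increasing sequences of arbitrary
sets. -/
theorem IsNestedNet.netContent_iUnion_le (hb : IsNestedNet b) {A : ℕ → Set X} (hA : Monotone A)
    {c : ℝ≥0∞} (hc : ∀ i, netContent b τ (A i) ≤ c) : netContent b τ (⋃ i, A i) ≤ c := by
  classical
  rcases eq_or_ne c ⊤ with rfl | hctop
  · exact le_top
  refine ENNReal.le_of_forall_pos_le_add fun ε hε _ => ?_
  obtain ⟨ε', hε', hsum⟩ := ENNReal.exists_pos_sum_of_countable (ENNReal.coe_pos.2 hε).ne' ℕ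
  have hfin : ∀ i, netContent b τ (A i) ≠ ⊤ := fun i => ((hc i).trans_lt hctop.lt_top).ne
  have : ∀ i, ∃ F : Set (ℕ × Y), A i ⊆ cellUnion b F ∧
      cellCost τ F ≤ netContent b τ (A i) + ε' i := by
    intro i
    have : netContent b τ (A i) < netContent b τ (A i) + ε' i :=
      ENNReal.lt_add_right (hfin i) (ENNReal.coe_pos.2 (hε' i)).ne'
    obtain ⟨F, hF⟩ := iInf_lt_iff.1 this
    obtain ⟨hF, hlt⟩ := iInf_lt_iff.1 hF
    exact ⟨F, hF, hlt.le⟩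
  choose F hAF hF using this
  let W : ℕ → Set (ℕ × Y) := fun i => Nat.rec (F 0) (fun i V => maximalCells b (V ∪ F (i + 1))) i
  have hW : ∀ i, W (i + 1) = maximalCells b (W i ∪ F (i + 1)) := fun i => rfl
  have hWsub : ∀ i, W i ⊆ ⋃ j, F j := by
    intro i
    induction i with
    | zero => exact subset_iUnion F 0
    | succ i ih => exact fun q hq => hq.1.elim (fun h => ih h) (fun h => mem_iUnion.2 ⟨_, h⟩)
  have hWcov : ∀ i, A i ⊆ cellUnion b (W i) := by
    intro i
    cases i with
    | zero => exact hAF 0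
    | succ i =>
      rw [hW, hb.cellUnion_maximalCells]
      exact (hAF _).trans (cellUnion_mono subset_union_right)
  have hWcost : ∀ i, cellCost τ (W i) ≤
      netContent b τ (A i) + ∑ j ∈ Finset.range (i + 1), (ε' j : ℝ≥0∞) := by
    intro i
    induction i with
    | zero => simpa [W] using hF 0
    | succ i ih =>
      have h1 := cellCost_maximalCells_add_le (τ := τ) (hWcov i)
        ((hA i.le_succ).trans (hAF (i + 1)))
      rw [← ENNReal.add_le_add_iff_right (hfin i), hW]
      refine h1.trans ((add_le_add ih (hF (i + 1))).trans_eq ?_)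
      rw [Finset.sum_range_succ _ (i + 1)]
      ring
  have hmax : ∀ q ∈ maximalCells b (⋃ j, F j), ∀ᶠ i in atTop, q ∈ W i := by
    intro q hq
    obtain ⟨m, hm⟩ := mem_iUnion.1 hq.1
    have hstep : ∀ i, q ∈ W i ∪ F (i + 1) → q ∈ W (i + 1) := fun i hi =>
      ⟨hi, fun q' hq' => hq.2 q' (hq'.elim (fun h => hWsub i h) fun h => mem_iUnion.2 ⟨_, h⟩)⟩
    filter_upwards [eventually_ge_atTop m] with i hi
    induction i, hi using Nat.le_induction with
    | base =>
      cases m with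
      | zero => exact hm
      | succ m => exact hstep m (Or.inr hm)
    | succ i _ ih => exact hstep i (Or.inl ih)
  refine (netContent_le (F := maximalCells b (⋃ j, F j)) ?_).trans
    (cellCost_le_of_eventually hmax fun i => (hWcost i).trans
      (add_le_add (hc i) ((ENNReal.sum_le_tsum _).trans hsum.le)))
  rw [hb.cellUnion_maximalCells]
  exact iUnion_subset fun i => (hAF i).trans (cellUnion_mono (subset_iUnion F i))

/-- A fractional cover by cells costs at least the net content. Indeed the cells at which the total
weight accumulated from the coarser cells passes the threshold `t` form a cover for each
`t ∈ (0, 1]`, and the average of their costs over `t` is at most the cost of the fractional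
cover. -/
theorem IsNestedNet.netContent_le_of_weights [Countable Y] (hb : IsNestedNet b) (c : ℕ × Y → ℝ≥0)
    (N : ℕ) (hc : ∀ x ∈ A, 1 ≤ ∑ k ∈ Finset.range N, c (k, b k x)) :
    netContent b τ A ≤ ∑' q : ℕ × Y, τ q.1 * c q := by
  classical
  -- `s q` is the total weight of the cells strictly containing the cell `q`.
  let s : ℕ × Y → ℝ := fun q => if h : ∃ x, b q.1 x = q.2 then
    ∑ k ∈ Finset.range q.1, (c (k, b k h.choose) : ℝ) else 0
  have hs : ∀ k x, s (k, b k x) = ∑ l ∈ Finset.range k, (c (l, b l x) : ℝ) := by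
    intro k x
    have h : ∃ y, b k y = b k x := ⟨x, rfl⟩
    simp only [s, dif_pos h]
    refine Finset.sum_congr rfl fun l hl => ?_
    rw [hb (Finset.mem_range.1 hl).le h.choose_spec]
  let I : ℕ × Y → Set ℝ := fun q => Ioc (s q) (s q + c q)
  have key : ∀ t ∈ Ioc (0 : ℝ) 1,
      netContent b τ A ≤ ∑' q : ℕ × Y, (I q).indicator (fun _ => τ q.1) t := by
    intro t ht
    have hcov : A ⊆ cellUnion b {q | t ∈ I q} := by
      intro x hx
      have hex : ∃ k, t ≤ ∑ l ∈ Finset.range k, (c (l, b l x) : ℝ) :=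
        ⟨N, ht.2.trans (by exact_mod_cast hc x hx)⟩
      obtain ⟨k, hk⟩ : ∃ k, Nat.find hex = k + 1 := by
        refine Nat.exists_eq_succ_of_ne_zero fun h0 => ?_
        have := Nat.find_spec hex
        rw [h0] at this
        simp only [Finset.range_zero, Finset.sum_empty] at this
        exact absurd ht.1 this.not_gt
      have h1 := Nat.find_spec hex
      rw [hk, Finset.sum_range_succ] at h1
      have h2 := Nat.find_min hex (m := k) (by omega)
      refine ⟨k, ?_, ?_⟩
      · rw [hs]; exact not_le.1 h2
      · rw [hs]; exact h1
    refine (netContent_le hcov).trans_eq (tsum_congr fun q => ?_)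
    simp [indicator]
  calc netContent b τ A = ∫⁻ _ in Ioc (0 : ℝ) 1, netContent b τ A := by simp
    _ ≤ ∫⁻ t in Ioc (0 : ℝ) 1, ∑' q : ℕ × Y, (I q).indicator (fun _ => τ q.1) t :=
        setLIntegral_mono' measurableSet_Ioc key
    _ ≤ ∫⁻ t, ∑' q : ℕ × Y, (I q).indicator (fun _ => τ q.1) t := setLIntegral_le_lintegral _ _
    _ = ∑' q : ℕ × Y, ∫⁻ t, (I q).indicator (fun _ => τ q.1) t :=
        lintegral_tsum fun q => (measurable_const.indicator measurableSet_Ioc).aemeasurable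
    _ = ∑' q : ℕ × Y, τ q.1 * c q := by
        refine tsum_congr fun q => ?_
        rw [lintegral_indicator_const measurableSet_Ioc, Real.volume_Ioc, add_sub_cancel_left,
          ENNReal.ofReal_coe_nnreal]

end NetContent

/-! ### Compact subsets of analytic sets -/

section Capacity

theorem isCompact_setOf_forall_le (u : ℕ → ℕ) : IsCompact {x : ℕ → ℕ | ∀ i, x i ≤ u i} := by
  convert isCompact_univ_pi (s := fun i => Iic (u i)) fun i => (finite_Iic (u i)).isCompact
  ext x
  simp [Pi.le_def]

/-- A neighbourhood of the compact product `∏ i, [0, u i]` in Baire space contains all sequences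
with sufficiently many initial terms bounded by `u`. -/
theorem exists_forall_lt_le_subset {u : ℕ → ℕ} {V : Set (ℕ → ℕ)} (hV : IsOpen V)
    (huV : {x | ∀ i, x i ≤ u i} ⊆ V) : ∃ k, {x : ℕ → ℕ | ∀ i < k, x i ≤ u i} ⊆ V := by
  have hd : ∀ x ∈ V, ∃ d, PiNat.cylinder x d ⊆ V := fun x hx => by
    obtain ⟨s, ⟨y, d, rfl⟩, hxs, hsV⟩ :=
      (PiNat.isTopologicalBasis_cylinders (fun _ : ℕ => ℕ)).exists_subset_of_mem_open hx hV
    exact ⟨d, by rwa [← PiNat.mem_cylinder_iff_eq.1 hxs] at hsV⟩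
  choose! d hd using hd
  obtain ⟨t, ht, htc⟩ := (isCompact_setOf_forall_le u).elim_nhds_subcover
    (fun x => PiNat.cylinder x (d x)) fun x _ =>
    (PiNat.isOpen_cylinder (fun _ : ℕ => ℕ) x (d x)).mem_nhds (PiNat.self_mem_cylinder x _)
  refine ⟨t.sup d, fun y hy => ?_⟩
  have hmem : (fun i => min (y i) (u i)) ∈ {x : ℕ → ℕ | ∀ i, x i ≤ u i} :=
    fun i => min_le_right _ _
  obtain ⟨x, hxt, hx⟩ := mem_iUnion₂.1 (htc hmem)
  refine hd x (huV (ht x hxt)) (PiNat.mem_cylinder_iff.2 fun i hi => ?_)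
  rw [← PiNat.mem_cylinder_iff.1 hx i hi, min_eq_left (hy i (hi.trans_le (Finset.le_sup hxt)))]

/-- Capacitability: if `M` is continuous along increasing sequences of arbitrary sets, then an
analytic set of `M`-value larger than `c` contains a compact set all of whose open neighbourhoods
contain a subset of the analytic set of `M`-value larger than `c`. -/
theorem exists_isCompact_of_analyticSet {X : Type*} [TopologicalSpace X] {M : Set X → ℝ≥0∞}
    (hM : ∀ (A : ℕ → Set X), Monotone A → ∀ c, (∀ i, M (A i) ≤ c) → M (⋃ i, A i) ≤ c)
    {E : Set X} (hE : AnalyticSet E) (hne : E.Nonempty) {c : ℝ≥0∞} (hc : c < M E) :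
    ∃ K ⊆ E, IsCompact K ∧ ∀ U, IsOpen U → K ⊆ U → ∃ A ⊆ E ∩ U, c < M A := by
  rw [AnalyticSet] at hE
  obtain ⟨f, hf, rfl⟩ := hE.resolve_left hne.ne_empty
  have step : ∀ (N : {N : Set (ℕ → ℕ) // c < M (f '' N)}) (k : ℕ),
      ∃ m, c < M (f '' (N.1 ∩ {x | x k ≤ m})) := by
    intro N k
    by_contra! h
    refine (hM (fun m => f '' (N.1 ∩ {x | x k ≤ m})) (fun m m' hm => ?_) c h).not_gt ?_
    · exact image_mono (inter_subset_inter_right _ fun x (hx : x k ≤ m) => hx.trans hm)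
    · rw [← image_iUnion, ← inter_iUnion]
      have : ⋃ m, {x : ℕ → ℕ | x k ≤ m} = univ :=
        iUnion_eq_univ_iff.2 fun x => ⟨x k, le_refl (x k)⟩
      rw [this, inter_univ]
      exact N.2
  choose m hm using step
  let N : ℕ → {N : Set (ℕ → ℕ) // c < M (f '' N)} := fun k =>
    Nat.rec ⟨univ, by rwa [image_univ]⟩ (fun k N => ⟨_, hm N k⟩) k
  let u : ℕ → ℕ := fun k => m (N k) k
  have hN : ∀ k, (N k).1 = {x | ∀ i < k, x i ≤ u i} := by
    intro k
    induction k with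
    | zero => simp [N]
    | succ k ih =>
      have : (N (k + 1)).1 = (N k).1 ∩ {x | x k ≤ u k} := rfl
      rw [this, ih]
      ext x
      exact Nat.forall_lt_succ_right.symm
  refine ⟨f '' {x | ∀ i, x i ≤ u i}, image_subset_range _ _,
    (isCompact_setOf_forall_le u).image hf, fun U hU hKU => ?_⟩
  obtain ⟨k, hk⟩ := exists_forall_lt_le_subset (hU.preimage hf) (image_subset_iff.1 hKU)
  refine ⟨f '' (N k).1, subset_inter (image_subset_range _ _) ?_, (N k).2⟩
  rw [hN, image_subset_iff]
  exact hk

end Capacity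

/-! ### Duality between fractional covers and measures -/

section Duality

/-- The value at `x` of the weighted sum of the indicator functions of the sets `U i`. -/
noncomputable def weightAt {X ι : Type*} (U : ι → Set X) (c : ι →₀ ℝ≥0) (x : X) : ℝ :=
  c.sum fun i a => (a : ℝ) * (U i).indicator 1 x

/-- The cost of the weights `c`, if a unit of weight on the `i`-th set costs `w i`. -/
noncomputable def weightCost {ι : Type*} (w : ι → ℝ≥0) (c : ι →₀ ℝ≥0) : ℝ :=
  c.sum fun i a => (a : ℝ) * w i

variable {X ι : Type*} {U : ι → Set X} {w : ι → ℝ≥0} {K : Set X}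

theorem weightAt_add (c c' : ι →₀ ℝ≥0) (x : X) :
    weightAt U (c + c') x = weightAt U c x + weightAt U c' x :=
  Finsupp.sum_add_index' (by simp) (by intros; push_cast; ring)

theorem weightCost_add (c c' : ι →₀ ℝ≥0) :
    weightCost w (c + c') = weightCost w c + weightCost w c' :=
  Finsupp.sum_add_index' (by simp) (by intros; push_cast; ring)

theorem weightAt_smul (a : ℝ≥0) (c : ι →₀ ℝ≥0) (x : X) :
    weightAt U (a • c) x = a * weightAt U c x := by
  rw [weightAt, Finsupp.sum_smul_index' (by simp), weightAt, Finsupp.mul_sum]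
  simp [mul_assoc]

theorem weightCost_smul (a : ℝ≥0) (c : ι →₀ ℝ≥0) :
    weightCost w (a • c) = a * weightCost w c := by
  rw [weightCost, Finsupp.sum_smul_index' (by simp), weightCost, Finsupp.mul_sum]
  simp [mul_assoc]

theorem weightCost_nonneg (c : ι →₀ ℝ≥0) : 0 ≤ weightCost w c :=
  Finset.sum_nonneg fun i _ => mul_nonneg (c i).2 (w i).2

/-- The infimum of the costs of finitely supported weights on the sets `U i` whose weighted sum
of indicators dominates `f` on `K`. The infimum has the junk value `0` if there are no such weights, which does
not happen for continuous `f` if the sets `U i` are an open cover of the compact set `K`. -/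
noncomputable def fractionalCost (U : ι → Set X) (w : ι → ℝ≥0) (K : Set X) (f : X → ℝ) : ℝ :=
  sInf (weightCost w '' {c | ∀ x ∈ K, f x ≤ weightAt U c x})

theorem fractionalCost_le {f : X → ℝ} {c : ι →₀ ℝ≥0} (h : ∀ x ∈ K, f x ≤ weightAt U c x) :
    fractionalCost U w K f ≤ weightCost w c :=
  csInf_le ⟨0, by rintro _ ⟨c, -, rfl⟩; exact weightCost_nonneg c⟩ ⟨c, h, rfl⟩

theorem fractionalCost_nonneg (f : X → ℝ) : 0 ≤ fractionalCost U w K f :=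
  Real.sInf_nonneg (by rintro _ ⟨c, -, rfl⟩; exact weightCost_nonneg c)

theorem fractionalCost_eq_zero {f : X → ℝ} (hf : ∀ x ∈ K, f x ≤ 0) :
    fractionalCost U w K f = 0 := by
  refine (fractionalCost_nonneg f).antisymm' ?_
  have := fractionalCost_le (U := U) (w := w) (c := 0) (f := f) (K := K)
    (by simpa [weightAt] using hf)
  simpa [weightCost] using this

theorem fractionalCost_le_weight {f : X → ℝ} (i : ι)
    (hf : ∀ x ∈ K, f x ≤ (U i).indicator 1 x) : fractionalCost U w K f ≤ w i := by
  have := fractionalCost_le (U := U) (w := w) (c := Finsupp.single i 1) (f := f) (K := K)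
    (by simpa [weightAt] using hf)
  simpa [weightCost] using this

theorem fractionalCost_smul_le {f : X → ℝ} {a : ℝ} (ha : 0 < a)
    (hne : ∃ c : ι →₀ ℝ≥0, ∀ x ∈ K, f x ≤ weightAt U c x) :
    fractionalCost U w K (a • f) ≤ a * fractionalCost U w K f := by
  rw [mul_comm, ← div_le_iff₀ ha]
  refine le_csInf (Set.Nonempty.image _ hne) ?_
  rintro _ ⟨c, hc, rfl⟩
  rw [div_le_iff₀ ha, mul_comm]
  lift a to ℝ≥0 using ha.le
  rw [← weightCost_smul]
  refine fractionalCost_le fun x hx => ?_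
  rw [weightAt_smul]
  exact mul_le_mul_of_nonneg_left (hc x hx) a.2

theorem fractionalCost_smul {f : X → ℝ} {a : ℝ} (ha : 0 < a)
    (hne : ∃ c : ι →₀ ℝ≥0, ∀ x ∈ K, f x ≤ weightAt U c x)
    (hne' : ∃ c : ι →₀ ℝ≥0, ∀ x ∈ K, (a • f) x ≤ weightAt U c x) :
    fractionalCost U w K (a • f) = a * fractionalCost U w K f := by
  refine (fractionalCost_smul_le ha hne).antisymm ?_
  have := fractionalCost_smul_le (w := w) (inv_pos.2 ha) hne'
  rwa [smul_smul, inv_mul_cancel₀ ha.ne', one_smul, inv_mul_eq_div, le_div_iff₀ ha, mul_comm]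
    at this

theorem fractionalCost_add_le {f g : X → ℝ}
    (hf : ∃ c : ι →₀ ℝ≥0, ∀ x ∈ K, f x ≤ weightAt U c x)
    (hg : ∃ c : ι →₀ ℝ≥0, ∀ x ∈ K, g x ≤ weightAt U c x) :
    fractionalCost U w K (f + g) ≤ fractionalCost U w K f + fractionalCost U w K g := by
  rw [← sub_le_iff_le_add']
  refine le_csInf (Set.Nonempty.image _ hg) ?_
  rintro _ ⟨c, hc, rfl⟩
  rw [sub_le_comm]
  refine le_csInf (Set.Nonempty.image _ hf) ?_
  rintro _ ⟨c', hc', rfl⟩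
  rw [sub_le_iff_le_add, ← weightCost_add]
  refine fractionalCost_le fun x hx => ?_
  rw [weightAt_add]
  exact add_le_add (hc' x hx) (hc x hx)

variable [TopologicalSpace X]

/-- The weighted sum of indicators of open sets can only increase near a given point. -/
theorem eventually_weightAt_le (hU : ∀ i, IsOpen (U i)) (c : ι →₀ ℝ≥0) (x : X) :
    ∀ᶠ y in 𝓝 x, weightAt U c x ≤ weightAt U c y := by
  have : ∀ᶠ y in 𝓝 x, ∀ i ∈ c.support, x ∈ U i → y ∈ U i := by
    rw [Filter.eventually_all_finset]
    intro i _
    by_cases hx : x ∈ U i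
    · filter_upwards [(hU i).mem_nhds hx] with y hy _ using hy
    · simp [hx]
  filter_upwards [this] with y hy
  refine Finset.sum_le_sum fun i hi => mul_le_mul_of_nonneg_left ?_ (c i).2
  by_cases hx : x ∈ U i
  · simp [hx, hy i hi hx]
  · simp only [indicator_of_notMem hx]
    exact indicator_nonneg (fun _ _ => zero_le_one) y

theorem exists_weightAt_ge (hU : ∀ i, IsOpen (U i)) (hK : IsCompact K) (hKU : K ⊆ ⋃ i, U i)
    (B : ℝ) : ∃ c : ι →₀ ℝ≥0, ∀ x ∈ K, B ≤ weightAt U c x := by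
  obtain ⟨t, ht⟩ := hK.elim_finite_subcover U hU hKU
  refine ⟨Finsupp.indicator t fun _ _ => B.toNNReal, fun x hx => ?_⟩
  obtain ⟨i, hi, hxi⟩ := mem_iUnion₂.1 (ht hx)
  rw [weightAt, Finsupp.sum_of_support_subset _ (Finsupp.support_indicator_subset t _) _ (by simp)]
  refine le_trans ?_ (Finset.single_le_sum (f := fun i =>
    ((Finsupp.indicator t fun _ _ => B.toNNReal) i : ℝ) * (U i).indicator 1 x) (fun j _ =>
      mul_nonneg (NNReal.coe_nonneg _) (indicator_nonneg (fun _ _ => zero_le_one) x)) hi)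
  simp [hi, hxi, Finsupp.indicator_of_mem]

variable [T2Space X] [LocallyCompactSpace X] [MeasurableSpace X] [BorelSpace X]

/-- If every fractional cover of the compact set `K` by the open sets `U i` with weights `w i` costs
at least `a > 0`, then `K` carries a nonzero Radon measure with `μ (U i) ≤ w i` for all `i`. The
measure represents a linear functional which the Hahn-Banach theorem provides below the sublinear
functional `fractionalCost`. -/
theorem exists_measure_le_of_fractionalCost (hU : ∀ i, IsOpen (U i)) (hK : IsCompact K)
    (hKU : K ⊆ ⋃ i, U i) {a : ℝ} (ha : 0 < a)
    (hcost : ∀ c : ι →₀ ℝ≥0, (∀ x ∈ K, 1 ≤ weightAt U c x) → a ≤ weightCost w c) :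
    ∃ μ : Measure X, μ.Regular ∧ μ ≠ 0 ∧ μ Kᶜ = 0 ∧ ∀ i, μ (U i) ≤ w i := by
  have hne : ∀ f : CompactlySupportedContinuousMap X ℝ, ∃ c : ι →₀ ℝ≥0, ∀ x ∈ K,
      f x ≤ weightAt U c x := by
    intro f
    obtain ⟨B, hB⟩ := (hK.image f.continuous).bddAbove
    obtain ⟨c, hc⟩ := exists_weightAt_ge hU hK hKU B
    exact ⟨c, fun x hx => (hB (mem_image_of_mem f hx)).trans (hc x hx)⟩
  let P : CompactlySupportedContinuousMap X ℝ → ℝ := fun f => fractionalCost U w K f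
  obtain ⟨φ₀, hφ1, hφc, -⟩ :=
    exists_continuousMap_one_of_isCompact_subset_isOpen hK isOpen_univ (subset_univ K)
  let φ : CompactlySupportedContinuousMap X ℝ := ⟨φ₀, hφc⟩
  have hφ : ∀ x ∈ K, φ x = 1 := fun x hx => hφ1 hx
  have hPφ : a ≤ P φ := by
    refine le_csInf (Set.Nonempty.image _ (hne φ)) ?_
    rintro _ ⟨c, hc, rfl⟩
    exact hcost c fun x hx => (hφ x hx).symm.trans_le (hc x hx)
  have hφ0 : φ ≠ 0 := by
    intro h
    have : P φ = 0 := fractionalCost_eq_zero fun x _ => by simp [h]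
    linarith
  have hPsmul : ∀ s : ℝ, 0 < s → ∀ f, P (s • f) = s * P f := fun s hs f =>
    fractionalCost_smul hs (hne f) (hne (s • f))
  obtain ⟨g, hgφ, hgP⟩ := exists_extension_of_le_sublinear
    (LinearPMap.mkSpanSingleton (K := ℝ) φ (P φ) hφ0) P hPsmul
    (fun f g => fractionalCost_add_le (hne f) (hne g)) (by
      rintro ⟨x, hx⟩
      obtain ⟨s, rfl⟩ := Submodule.mem_span_singleton.1 hx
      rw [LinearPMap.mkSpanSingleton'_apply, RingHom.id_apply, smul_eq_mul]
      rcases le_or_gt s 0 with hs | hs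
      · exact (mul_nonpos_of_nonpos_of_nonneg hs (ha.le.trans hPφ)).trans (fractionalCost_nonneg _)
      · exact (hPsmul s hs φ).ge)
  have hgφ' : g φ = P φ := by
    have := hgφ ⟨φ, Submodule.mem_span_singleton_self φ⟩
    rwa [LinearPMap.mkSpanSingleton_apply] at this
  have hgpos : ∀ f, 0 ≤ f → 0 ≤ g f := by
    intro f hf
    have h1 := hgP (-f)
    have h2 : P (-f) = 0 := fractionalCost_eq_zero fun x _ => by
      simpa using hf x
    rw [map_neg, h2] at h1
    linarith
  let Λ : CompactlySupportedContinuousMap X ℝ →ₚ[ℝ] ℝ := PositiveLinearMap.mk₀ g hgpos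
  have hΛ : ∀ f, Λ f = g f := fun f => rfl
  have hopen : ∀ (V : Set X) (B : ℝ), IsOpen V →
      (∀ f : CompactlySupportedContinuousMap X ℝ, (∀ x, f x ≤ V.indicator 1 x) → P f ≤ B) →
      RealRMK.rieszMeasure Λ V ≤ ENNReal.ofReal B := by
    intro V B hV hB
    rw [hV.measure_eq_iSup_isCompact]
    refine iSup₂_le fun C hCV => iSup_le fun hC => ?_
    obtain ⟨f, hf1, hfc, hf0, hf01⟩ :=
      exists_continuousMap_one_of_isCompact_subset_isOpen hC hV hCV
    refine (RealRMK.rieszMeasure_le_of_eq_one Λ (f := ⟨f, hfc⟩) (fun x => (hf01 x).1) hC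
      fun x hx => hf1 hx).trans (ENNReal.ofReal_le_ofReal ?_)
    refine (hgP _).trans (hB _ fun x => ?_)
    change f x ≤ V.indicator 1 x
    by_cases hx : x ∈ V
    · simpa [hx] using (hf01 x).2
    · have : x ∉ tsupport f := fun h => hx (hf0 h)
      simp [hx, image_eq_zero_of_notMem_tsupport this]
  refine ⟨RealRMK.rieszMeasure Λ, inferInstance, fun h0 => ?_, ?_, fun i => ?_⟩
  · have := RealRMK.integral_rieszMeasure Λ φ
    rw [h0, integral_zero_measure, hΛ, hgφ'] at this
    linarith
  · refine le_antisymm ?_ zero_le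
    refine (hopen _ 0 hK.isClosed.isOpen_compl fun f hf => ?_).trans_eq ENNReal.ofReal_zero
    exact (fractionalCost_eq_zero fun x hx => by simpa [hx] using hf x).le
  · refine (hopen _ _ (hU i) fun f hf => fractionalCost_le_weight i fun x _ => hf x).trans_eq ?_
    exact ENNReal.ofReal_coe_nnreal

end Duality

/-! ### From net content to measures -/

section Frostman

variable {X Y ι : Type*} [Countable Y] {b : ℕ → X → Y} {t : ℕ → ℝ≥0} {U : ι → Set X}
  {w : ι → ℝ≥0} {C : ℝ≥0} {κ : ι → ℕ} {S : ι → Finset Y} {A E : Set X}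

/-- If each `U i` can be covered within `E` by cells of a single partition, of total cost at most
`C * w i`, then fractional covers by the sets `U i` are bounded below by the net content. -/
theorem IsNestedNet.netContent_le_weightCost (hb : IsNestedNet b)
    (hS : ∀ i, ∀ x ∈ E ∩ U i, b (κ i) x ∈ S i) (hC : ∀ i, (S i).card * t (κ i) ≤ C * w i)
    (hAE : A ⊆ E) {c : ι →₀ ℝ≥0} (hc : ∀ x ∈ A, 1 ≤ weightAt U c x) :
    netContent b (fun k => t k) A ≤ ENNReal.ofReal (C * weightCost w c) := by
  classical
  -- `g q` is the weight which the cell `q` inherits from the sets `U i`.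
  let g : ℕ × Y → ℝ≥0 := fun q => ∑ i ∈ c.support, if κ i = q.1 ∧ q.2 ∈ S i then c i else 0
  have hg : ∀ x ∈ A, 1 ≤ ∑ k ∈ Finset.range (c.support.sup κ + 1), g (k, b k x) := by
    intro x hx
    rw [← NNReal.coe_le_coe]
    refine (hc x hx).trans ?_
    simp only [g]
    rw [Finset.sum_comm, NNReal.coe_sum, weightAt, Finsupp.sum]
    refine Finset.sum_le_sum fun i hi => ?_
    have hmem : κ i ∈ Finset.range (c.support.sup κ + 1) :=
      Finset.mem_range.2 (Nat.lt_succ_of_le (Finset.le_sup hi))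
    by_cases hxU : x ∈ U i
    · refine le_trans ?_ (NNReal.coe_le_coe.2 (Finset.single_le_sum (fun _ _ => zero_le) hmem))
      simp [hxU, hS i x ⟨hAE hx, hxU⟩]
    · simp only [indicator_of_notMem hxU, mul_zero]
      exact NNReal.coe_nonneg _
  refine (hb.netContent_le_of_weights g _ hg).trans ?_
  have hsum : ∀ i, ∑' q : ℕ × Y,
      (t q.1 : ℝ≥0∞) * ((if κ i = q.1 ∧ q.2 ∈ S i then c i else 0 : ℝ≥0)) =
        c i * ((S i).card * t (κ i)) := by
    intro i
    rw [tsum_eq_sum (s := {κ i} ×ˢ S i)]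
    · rw [Finset.sum_product, Finset.sum_singleton,
        Finset.sum_congr rfl (g := fun _ => (t (κ i) : ℝ≥0∞) * c i)
          (fun v hv => by rw [if_pos ⟨rfl, hv⟩]), Finset.sum_const, nsmul_eq_mul]
      ring
    · rintro ⟨k, v⟩ hq
      rw [if_neg, ENNReal.coe_zero, mul_zero]
      rintro ⟨rfl, hv⟩
      exact hq (Finset.mem_product.2 ⟨Finset.mem_singleton_self _, hv⟩)
  calc ∑' q : ℕ × Y, (t q.1 : ℝ≥0∞) * g q
      = ∑ i ∈ c.support, (c i : ℝ≥0∞) * ((S i).card * t (κ i)) := by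
        simp only [g, ENNReal.ofNNReal_finsetSum, Finset.mul_sum]
        rw [Summable.tsum_finsetSum fun i _ => ENNReal.summable]
        exact Finset.sum_congr rfl fun i _ => hsum i
    _ ≤ ∑ i ∈ c.support, (c i : ℝ≥0∞) * (C * w i) :=
        Finset.sum_le_sum fun i _ => mul_le_mul_right (by exact_mod_cast hC i) _
    _ = ENNReal.ofReal (C * weightCost w c) := by
        rw [weightCost, Finsupp.sum, Finset.mul_sum, ENNReal.ofReal_sum_of_nonneg
          fun i _ => by positivity]
        refine Finset.sum_congr rfl fun i _ => ?_
        rw [← NNReal.coe_mul, ← NNReal.coe_mul, ENNReal.ofReal_coe_nnreal]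
        push_cast
        ring

/-- An abstract Frostman lemma for analytic sets of positive net content. -/
theorem IsNestedNet.exists_measure_le [TopologicalSpace X] [T2Space X] [LocallyCompactSpace X]
    [MeasurableSpace X] [BorelSpace X] (hb : IsNestedNet b) (hE : AnalyticSet E)
    (hpos : 0 < netContent b (fun k => t k) E) (hU : ∀ i, IsOpen (U i)) (hEU : E ⊆ ⋃ i, U i)
    (hS : ∀ i, ∀ x ∈ E ∩ U i, b (κ i) x ∈ S i) (hC : ∀ i, (S i).card * t (κ i) ≤ C * w i) :
    ∃ K ⊆ E, IsCompact K ∧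
      ∃ μ : Measure X, μ.Regular ∧ μ ≠ 0 ∧ μ Kᶜ = 0 ∧ ∀ i, μ (U i) ≤ w i := by
  have hne : E.Nonempty := by
    rw [nonempty_iff_ne_empty]
    rintro rfl
    refine hpos.ne' (le_antisymm ?_ zero_le)
    exact (netContent_le (empty_subset (cellUnion b ∅))).trans_eq (by simp [cellCost])
  obtain ⟨ε, hε0, hε⟩ := ENNReal.lt_iff_exists_nnreal_btwn.1 hpos
  obtain ⟨K, hKE, hK, hKA⟩ := exists_isCompact_of_analyticSet
    (M := netContent b (fun k => t k)) (fun A hA c hc => hb.netContent_iUnion_le hA hc) hE hne hε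
  have hε0 : (0 : ℝ) < ε := by exact_mod_cast hε0
  refine ⟨K, hKE, hK, exists_measure_le_of_fractionalCost hU hK (hKE.trans hEU)
    (a := ε / (C + 1)) (by positivity) fun c hc => ?_⟩
  obtain ⟨A, hA, hεA⟩ := hKA (interior {x | 1 ≤ weightAt U c x}) isOpen_interior fun x hx => by
    rw [mem_interior_iff_mem_nhds]
    filter_upwards [eventually_weightAt_le hU c x] with y hy using (hc x hx).trans hy
  have := hεA.trans_le (hb.netContent_le_weightCost (t := t) hS hC (hA.trans inter_subset_left)
    fun x hx => interior_subset (s := {x | 1 ≤ weightAt U c x}) (hA hx).2)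
  rw [ENNReal.lt_ofReal_iff_toReal_lt ENNReal.coe_ne_top, ENNReal.coe_toReal] at this
  rw [div_le_iff₀ (by positivity)]
  nlinarith [weightCost_nonneg (w := w) c]

end Frostman

/-! ### The dyadic net adapted to the intrinsic cylinders -/

section Geometry

variable {n : ℕ}

theorem mem_intrinsicCylinder_iff {p α r : ℝ} (hr : 0 < r) {z z₀ : SpaceTime n} :
    z ∈ intrinsicCylinder p r (r ^ α) z₀ ↔
      dist z.1 z₀.1 < r ∧ |z.2 - z₀.2| < r ^ (p + α * (2 - p)) := by
  have : (r ^ α) ^ (2 - p) * r ^ p = r ^ (p + α * (2 - p)) := by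
    rw [← Real.rpow_mul hr.le, ← Real.rpow_add hr, add_comm]
  rw [intrinsicCylinder, mem_prod, Metric.mem_ball, this, mem_Ioo, abs_lt, sub_lt_iff_lt_add',
    neg_lt_sub_iff_lt_add, sub_lt_iff_lt_add']

theorem isOpen_intrinsicCylinder (p r θ : ℝ) (z₀ : SpaceTime n) :
    IsOpen (intrinsicCylinder p r θ z₀) :=
  Metric.isOpen_ball.prod isOpen_Ioo

/-- The content `parabolicHausdorffPre` is bounded by the cost of covers indexed by any countable
type. -/
theorem parabolicHausdorffPre_le_tsum {p α σ δ : ℝ} {E : Set (SpaceTime n)} {ι : Type*}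
    [Countable ι] (z : ι → SpaceTime n) (r : ι → ℝ) (hr : ∀ i, 0 < r i ∧ r i < δ)
    (hE : E ⊆ ⋃ i, intrinsicCylinder p (r i) (r i ^ α) (z i)) :
    parabolicHausdorffPre p α σ δ E ≤ ∑' i, ENNReal.ofReal (r i ^ σ) := by
  obtain ⟨e, he⟩ := Countable.exists_injective_nat ι
  have hz : ∀ i, Function.extend e z 0 (e i) = z i := he.extend_apply z 0
  have hr' : ∀ i, Function.extend e r 0 (e i) = r i := he.extend_apply r 0
  unfold parabolicHausdorffPre
  refine iInf_le_of_le (range e) <| iInf_le_of_le (Function.extend e z 0) <|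
    iInf_le_of_le (Function.extend e r 0) <| iInf_le_of_le ?_ <| iInf_le_of_le ?_ ?_
  · rintro _ ⟨i, rfl⟩
    rw [hr']
    exact hr i
  · simpa only [biUnion_range, hz, hr'] using hE
  · rw [tsum_range (fun j => ENNReal.ofReal (Function.extend e r 0 j ^ σ)) he]
    simp only [hr']
    exact le_rfl

/-- The dyadic code of a space-time point at level `k`: its cell is the half-open box with side
`2⁻ᵏ` in space and `2^(-⌈k β⌉₊)` in time. For `β ≥ 0` the latter is comparable to `(2⁻ᵏ) ^ β`,
while for `β ≤ 0` the time side is `1` at all levels. -/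
noncomputable def dyadicCode (β : ℝ) (k : ℕ) (z : SpaceTime n) : (Fin n → ℤ) × ℤ :=
  (fun i => ⌊(2 : ℝ) ^ k * z.1 i⌋, ⌊(2 : ℝ) ^ ⌈k * β⌉₊ * z.2⌋)

theorem floor_two_pow_mul_eq {d e : ℕ} (h : d ≤ e) {x y : ℝ}
    (hxy : ⌊(2 : ℝ) ^ e * x⌋ = ⌊(2 : ℝ) ^ e * y⌋) : ⌊(2 : ℝ) ^ d * x⌋ = ⌊(2 : ℝ) ^ d * y⌋ := by
  have key : ∀ u : ℝ, ⌊(2 : ℝ) ^ d * u⌋ = ⌊(2 : ℝ) ^ e * u⌋ / (2 : ℤ) ^ (e - d) := by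
    intro u
    rw [← Int.floor_div_cast_of_nonneg (by positivity)]
    congr 1
    rw [eq_div_iff (by positivity)]
    push_cast
    rw [mul_right_comm, ← pow_add, Nat.add_sub_cancel' h]
  rw [key, key, hxy]

theorem isNestedNet_dyadicCode (β : ℝ) (k₀ : ℕ) :
    IsNestedNet fun k => dyadicCode (n := n) β (k₀ + k) := by
  intro l k hlk x y h
  have hd : ⌈((k₀ + l : ℕ) : ℝ) * β⌉₊ ≤ ⌈((k₀ + k : ℕ) : ℝ) * β⌉₊ := by
    rcases le_or_gt 0 β with hβ | hβ
    · gcongr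
    · rw [Nat.ceil_eq_zero.2 (mul_nonpos_of_nonneg_of_nonpos (Nat.cast_nonneg _) hβ.le)]
      exact Nat.zero_le _
  obtain ⟨h1, h2⟩ := Prod.ext_iff.1 h
  refine Prod.ext (funext fun i => ?_) (floor_two_pow_mul_eq hd h2)
  exact floor_two_pow_mul_eq (by omega) (congrFun h1 i)

/-- The radius of a cylinder which contains a dyadic cell of level `k`, provided that it is at
most `1`. -/
noncomputable def cellRadius (n k : ℕ) : ℝ := (n + 1) * (1 / 2) ^ k

theorem cellRadius_pos (n k : ℕ) : 0 < cellRadius n k := by unfold cellRadius; positivity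

theorem cellRadius_antitone (n : ℕ) : Antitone (cellRadius n) := fun _ _ h =>
  mul_le_mul_of_nonneg_left (pow_le_pow_of_le_one (by norm_num) (by norm_num) h) (by positivity)

theorem mem_intrinsicCylinder_of_dyadicCode_eq {p α : ℝ} {k : ℕ} (hk : cellRadius n k ≤ 1)
    {z z₀ : SpaceTime n}
    (h : dyadicCode (p + α * (2 - p)) k z = dyadicCode (p + α * (2 - p)) k z₀) :
    z ∈ intrinsicCylinder p (cellRadius n k) (cellRadius n k ^ α) z₀ := by
  set β := p + α * (2 - p)
  have hfloor : ∀ (d : ℕ) (x y : ℝ), ⌊(2 : ℝ) ^ d * x⌋ = ⌊(2 : ℝ) ^ d * y⌋ →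
      |x - y| < (1 / 2) ^ d := by
    intro d x y hxy
    have := Int.abs_sub_lt_one_of_floor_eq_floor hxy
    rw [← mul_sub, abs_mul, abs_of_pos (by positivity), ← lt_div_iff₀' (by positivity)] at this
    rwa [one_div_pow]
  obtain ⟨h1, h2⟩ := Prod.ext_iff.1 h
  have hr := cellRadius_pos n k
  refine (mem_intrinsicCylinder_iff hr).2 ⟨?_, (hfloor _ _ _ h2).trans_le ?_⟩
  · have : dist z.1 z₀.1 ≤ n * (1 / 2) ^ k := by
      rw [EuclideanSpace.dist_eq]
      refine Real.sqrt_le_iff.2 ⟨by positivity, ?_⟩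
      calc ∑ i, dist (z.1 i) (z₀.1 i) ^ 2 ≤ ∑ _i : Fin n, ((1 / 2 : ℝ) ^ k) ^ 2 :=
            Finset.sum_le_sum fun i _ => pow_le_pow_left₀ dist_nonneg
              (by rw [Real.dist_eq]; exact (hfloor _ _ _ (congrFun h1 i)).le) 2
        _ = n * ((1 / 2 : ℝ) ^ k) ^ 2 := by simp
        _ ≤ (n * (1 / 2) ^ k) ^ 2 := by
            rw [mul_pow]
            gcongr
            exact_mod_cast Nat.le_self_pow two_ne_zero n
    refine this.trans_lt ?_
    unfold cellRadius
    gcongr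
    linarith
  · rcases le_or_gt 0 β with hβ | hβ
    · calc (1 / 2 : ℝ) ^ ⌈k * β⌉₊ = (1 / 2 : ℝ) ^ (⌈k * β⌉₊ : ℝ) := (Real.rpow_natCast _ _).symm
        _ ≤ (1 / 2 : ℝ) ^ (k * β) := Real.rpow_le_rpow_of_exponent_ge (by norm_num) (by norm_num)
            (Nat.le_ceil _)
        _ = ((1 / 2 : ℝ) ^ k) ^ β := by rw [Real.rpow_mul (by norm_num), Real.rpow_natCast]
        _ ≤ cellRadius n k ^ β := by
            refine Real.rpow_le_rpow (by positivity) ?_ hβ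
            exact le_mul_of_one_le_left (by positivity) (by linarith [n.cast_nonneg (α := ℝ)])
    · exact (pow_le_one₀ (by norm_num) (by norm_num)).trans
        (Real.one_le_rpow_of_pos_of_le_one_of_nonpos hr hk hβ.le)

/-- Covers by dyadic cells of levels at least `k₀`, each cell being enclosed in a cylinder of radius
less than `δ`, bound the Hausdorff content of scale `δ`. -/
theorem parabolicHausdorffPre_le_netContent {p α σ δ : ℝ} {k₀ : ℕ} (hk₀ : cellRadius n k₀ ≤ 1)
    (hδ : cellRadius n k₀ < δ) (E : Set (SpaceTime n)) :
    parabolicHausdorffPre p α σ δ E ≤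
      netContent (fun k => dyadicCode (p + α * (2 - p)) (k₀ + k))
        (fun k => ((cellRadius n (k₀ + k) ^ σ).toNNReal : ℝ≥0∞)) E := by
  classical
  set β := p + α * (2 - p)
  refine le_iInf₂ fun F hF => ?_
  let z : ℕ × ((Fin n → ℤ) × ℤ) → SpaceTime n := fun q =>
    if h : ∃ z, dyadicCode β (k₀ + q.1) z = q.2 then h.choose else 0
  have hz : ∀ k x, dyadicCode β (k₀ + k) (z (k, dyadicCode β (k₀ + k) x)) =
      dyadicCode β (k₀ + k) x := by
    intro k x
    have h : ∃ y, dyadicCode β (k₀ + k) y = dyadicCode β (k₀ + k) x := ⟨x, rfl⟩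
    simp only [z, dif_pos h]
    exact h.choose_spec
  have hle : ∀ k, cellRadius n (k₀ + k) ≤ cellRadius n k₀ := fun k =>
    cellRadius_antitone n (Nat.le_add_right _ _)
  refine (parabolicHausdorffPre_le_tsum (fun q : F => z q) (fun q => cellRadius n (k₀ + q.1.1))
    (fun q => ⟨cellRadius_pos _ _, (hle _).trans_lt hδ⟩) fun x hx => ?_).trans_eq ?_
  · obtain ⟨k, hk⟩ := hF hx
    refine mem_iUnion.2 ⟨⟨_, hk⟩, ?_⟩
    exact mem_intrinsicCylinder_of_dyadicCode_eq ((hle k).trans hk₀) (hz k x).symm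
  · exact tsum_subtype F fun q => ((cellRadius n (k₀ + q.1) ^ σ).toNNReal : ℝ≥0∞)

/-- Within a bounded set, a cylinder of radius `r` meets boundedly many dyadic cells of some level
`j = k₀ + k` with `2⁻ʲ ≤ 2 r`. This is expressed through the real numbers whose integer parts are
the entries of the dyadic code. -/
theorem exists_level_forall_abs_sub_lt {p α : ℝ} {E : Set (SpaceTime n)}
    (hE : Bornology.IsBounded E) (k₀ : ℕ) :
    ∃ m : ℕ, ∀ (z₀ : SpaceTime n) (r : ℝ), 0 < r → ∃ k, (1 / 2 : ℝ) ^ (k₀ + k) ≤ 2 * r ∧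
      ∃ (c : Fin n → ℝ) (s : ℝ), ∀ z ∈ E ∩ intrinsicCylinder p r (r ^ α) z₀,
        (∀ i, |(2 : ℝ) ^ (k₀ + k) * z.1 i - c i| < m) ∧
          |(2 : ℝ) ^ ⌈((k₀ + k : ℕ) : ℝ) * (p + α * (2 - p))⌉₊ * z.2 - s| < m := by
  set β := p + α * (2 - p)
  obtain ⟨R, hR0, hR⟩ := hE.exists_pos_norm_le
  set D : ℝ := 2 ^ ⌈(k₀ : ℝ) * β⌉₊
  have hx : ∀ z ∈ E, ∀ i, |z.1 i| ≤ R := fun z hz i =>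
    (PiLp.norm_apply_le z.1 i).trans ((norm_fst_le z).trans (hR z hz))
  have ht : ∀ z ∈ E, |z.2| ≤ R := fun z hz => (norm_snd_le z).trans (hR z hz)
  obtain ⟨m, hm⟩ := exists_nat_gt (2 + 2 ^ k₀ * R + D * R)
  have hk0R : 0 < 2 ^ k₀ * R := by positivity
  have hDR : R ≤ D * R := le_mul_of_one_le_left hR0.le (one_le_pow₀ one_le_two)
  refine ⟨m, fun z₀ r hr => ?_⟩
  rcases le_or_gt r ((1 / 2 : ℝ) ^ k₀) with hrk | hrk
  · -- Small cylinders are compared with cells of their own size.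
    obtain ⟨l, hl1, hl2⟩ := exists_nat_pow_near_of_lt_one hr
      (hrk.trans (pow_le_one₀ (by norm_num) (by norm_num)))
      (by norm_num : (0 : ℝ) < 1 / 2) (by norm_num)
    obtain ⟨k, hk⟩ : ∃ k, k₀ + k = max k₀ l := ⟨max k₀ l - k₀, by omega⟩
    have hrk' : r ≤ (1 / 2 : ℝ) ^ (k₀ + k) := by
      rw [hk]
      rcases max_choice k₀ l with h | h <;> rw [h] <;> assumption
    refine ⟨k, ?_, ?_⟩
    · rw [pow_succ] at hl1
      have : (1 / 2 : ℝ) ^ (k₀ + k) ≤ (1 / 2) ^ l :=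
        pow_le_pow_of_le_one (by norm_num) (by norm_num) (by omega)
      linarith
    set j := k₀ + k
    have hspace : ∀ z ∈ intrinsicCylinder p r (r ^ α) z₀, ∀ i,
        |(2 : ℝ) ^ j * z.1 i - 2 ^ j * z₀.1 i| < m := by
      intro z hz i
      have h1 : |z.1 i - z₀.1 i| < (1 / 2) ^ j := by
        refine lt_of_le_of_lt ?_ ((((mem_intrinsicCylinder_iff hr).1 hz).1).trans_le hrk')
        rw [dist_eq_norm]
        exact PiLp.norm_apply_le (z.1 - z₀.1) i
      rw [← mul_sub, abs_mul, abs_of_pos (by positivity)]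
      calc (2 : ℝ) ^ j * |z.1 i - z₀.1 i| ≤ 2 ^ j * (1 / 2) ^ j := by gcongr
        _ = 1 := by rw [← mul_pow]; norm_num
        _ < m := by linarith
    rcases le_or_gt 0 β with hβ | hβ
    · refine ⟨fun i => 2 ^ j * z₀.1 i, 2 ^ ⌈(j : ℝ) * β⌉₊ * z₀.2, fun z hz =>
        ⟨hspace z hz.2, ?_⟩⟩
      have h1 := ((mem_intrinsicCylinder_iff hr).1 hz.2).2
      have h2 : r ^ β ≤ (2 : ℝ) ^ (-(j * β)) := by
        refine (Real.rpow_le_rpow hr.le hrk' hβ).trans_eq ?_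
        rw [Real.rpow_neg zero_le_two, Real.rpow_mul zero_le_two, Real.rpow_natCast,
          ← Real.inv_rpow (by positivity), one_div, inv_pow]
      have h3 : (2 : ℝ) ^ ⌈(j : ℝ) * β⌉₊ ≤ 2 ^ (j * β + 1) := by
        rw [← Real.rpow_natCast]
        exact Real.rpow_le_rpow_of_exponent_le one_le_two
          (Nat.ceil_lt_add_one (by positivity)).le
      rw [← mul_sub, abs_mul, abs_of_pos (by positivity)]
      calc (2 : ℝ) ^ ⌈(j : ℝ) * β⌉₊ * |z.2 - z₀.2| ≤ 2 ^ (j * β + 1) * 2 ^ (-(j * β)) :=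
            mul_le_mul h3 (h1.le.trans h2) (abs_nonneg _) (by positivity)
        _ = 2 := by rw [← Real.rpow_add zero_lt_two]; simp
        _ < m := by linarith
    · -- For `β < 0` small cylinders are long in time, but the cells have time side `1`, so only
      -- boundedly many of them meet the bounded set over a given spatial cube.
      refine ⟨fun i => 2 ^ j * z₀.1 i, 0, fun z hz => ⟨hspace z hz.2, ?_⟩⟩
      rw [Nat.ceil_eq_zero.2 (mul_nonpos_of_nonneg_of_nonpos (Nat.cast_nonneg _) hβ.le)]
      rw [pow_zero, one_mul, sub_zero]
      linarith [ht z hz.1]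
  · -- For large cylinders, the cells of level `k₀` meeting the bounded set are enough.
    refine ⟨0, by rw [add_zero]; linarith, 0, 0, fun z hz => ⟨fun i => ?_, ?_⟩⟩
    · rw [add_zero, Pi.zero_apply, sub_zero, abs_mul, abs_of_pos (by positivity)]
      have : (2 : ℝ) ^ k₀ * |z.1 i| ≤ 2 ^ k₀ * R := by gcongr; exact hx z hz.1 i
      linarith
    · rw [add_zero, sub_zero, abs_mul, abs_of_pos (by positivity)]
      have : D * |z.2| ≤ D * R := by gcongr; exact ht z hz.1
      linarith

theorem floor_mem_Icc_of_abs_sub_lt {a c : ℝ} {m : ℕ} (h : |a - c| < m) :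
    ⌊a⌋ ∈ Finset.Icc (⌊c⌋ - m) (⌊c⌋ + m) := by
  rw [abs_sub_lt_iff] at h
  rw [Finset.mem_Icc, Int.le_floor, ← Int.lt_add_one_iff, Int.floor_lt]
  push_cast
  constructor <;> linarith [Int.floor_le c, Int.lt_floor_add_one c]

/-- Within a bounded set, each cylinder of radius `r` is covered by dyadic cells of a single level
`k₀ + k`, of total cost at most a constant times `(2 r) ^ σ`. -/
theorem exists_level_finset_dyadicCode {p α σ : ℝ} (hσ : 0 ≤ σ) {E : Set (SpaceTime n)}
    (hE : Bornology.IsBounded E) (k₀ : ℕ) :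
    ∃ C : ℝ≥0, ∀ (z₀ : SpaceTime n) (r : ℝ), 0 < r → ∃ (k : ℕ) (S : Finset ((Fin n → ℤ) × ℤ)),
      (∀ z ∈ E ∩ intrinsicCylinder p r (r ^ α) z₀,
        dyadicCode (p + α * (2 - p)) (k₀ + k) z ∈ S) ∧
      S.card * (cellRadius n (k₀ + k) ^ σ).toNNReal ≤ C * ((2 * r) ^ σ).toNNReal := by
  obtain ⟨m, hm⟩ := exists_level_forall_abs_sub_lt (p := p) (α := α) hE k₀
  refine ⟨(2 * m + 1) ^ n * (2 * m + 1) * ((n + 1 : ℝ) ^ σ).toNNReal, fun z₀ r hr => ?_⟩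
  obtain ⟨k, hk, c, s, hcs⟩ := hm z₀ r hr
  refine ⟨k, (Fintype.piFinset fun i => Finset.Icc (⌊c i⌋ - m) (⌊c i⌋ + m)) ×ˢ
    Finset.Icc (⌊s⌋ - m) (⌊s⌋ + m), fun z hz => ?_, ?_⟩
  · obtain ⟨h1, h2⟩ := hcs z hz
    exact Finset.mem_product.2 ⟨Fintype.mem_piFinset.2 fun i =>
      floor_mem_Icc_of_abs_sub_lt (h1 i), floor_mem_Icc_of_abs_sub_lt h2⟩
  · have hcard : ∀ a : ℤ, (Finset.Icc (a - m) (a + m)).card = 2 * m + 1 := by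
      intro a
      rw [Int.card_Icc]
      omega
    rw [Finset.card_product, Fintype.card_piFinset]
    simp only [hcard, Finset.prod_const, Finset.card_univ, Fintype.card_fin]
    push_cast
    rw [mul_assoc _ (Real.toNNReal _)]
    refine mul_le_mul_right ?_ _
    rw [← Real.toNNReal_mul (by positivity), ← Real.mul_rpow (by positivity) (by positivity)]
    refine Real.toNNReal_le_toNNReal (Real.rpow_le_rpow (cellRadius_pos _ _).le ?_ hσ)
    exact mul_le_mul_of_nonneg_left hk (by positivity)

end Geometry

theorem mainTheorem6 (n : ℕ) (p : ℝ) (hp : 2 ≤ p)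
    (Ω : Set (EuclideanSpace ℝ (Fin n))) (hΩ : IsOpen Ω) (T : ℝ) (hT : 0 < T)
    (σ α : ℝ) (hσ : 0 ≤ σ) (hα : 0 < α)
    (E : Set (SpaceTime n)) (hE : MeasurableSet E)
    (hEΩ : CompactlyContained E (spaceTimeCylinder Ω T))
    (hpos : 0 < parabolicHausdorff p α σ E) :
    ∃ μ : MeasureTheory.Measure (SpaceTime n),
      μ.Regular ∧ μ ≠ 0 ∧ CompactlyContained μ.support E ∧
        ∀ (z₀ : SpaceTime n) (r : ℝ), 0 < r →
          μ (intrinsicCylinder p r (r ^ α) z₀) ≤ ENNReal.ofReal ((2 * r) ^ σ) := by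
  obtain ⟨δ, hδ, hδE⟩ : ∃ δ : ℝ, 0 < δ ∧ 0 < parabolicHausdorffPre p α σ δ E := by
    simpa [parabolicHausdorff, lt_iSup_iff] using hpos
  obtain ⟨k₀, hk₀⟩ : ∃ k₀, cellRadius n k₀ < min δ 1 := by
    obtain ⟨k, hk⟩ := exists_pow_lt_of_lt_one (show 0 < min δ 1 / (n + 1) by positivity)
      (by norm_num : (1 / 2 : ℝ) < 1)
    exact ⟨k, by rwa [lt_div_iff₀' (by positivity)] at hk⟩
  obtain ⟨C, hC⟩ := exists_level_finset_dyadicCode (p := p) (α := α) hσ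
    (hEΩ.1.isBounded.subset subset_closure) k₀
  choose κ S hS hcost using fun i : {q : SpaceTime n × ℝ // 0 < q.2} => hC i.1.1 i.1.2 i.2
  obtain ⟨K, hKE, hK, μ, hμ, hμ0, hμK, hμU⟩ :=
    (isNestedNet_dyadicCode (n := n) (p + α * (2 - p)) k₀).exists_measure_le hE.analyticSet
    (t := fun k => (cellRadius n (k₀ + k) ^ σ).toNNReal)
    (U := fun i : {q : SpaceTime n × ℝ // 0 < q.2} => intrinsicCylinder p i.1.2 (i.1.2 ^ α) i.1.1)
    (w := fun i => ((2 * i.1.2) ^ σ).toNNReal)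
    (hδE.trans_le (parabolicHausdorffPre_le_netContent (hk₀.le.trans (min_le_right _ _))
      (hk₀.trans_le (min_le_left _ _)) E))
    (fun i => isOpen_intrinsicCylinder _ _ _ _)
    (fun z _ => mem_iUnion.2 ⟨⟨(z, 1), one_pos⟩,
      (mem_intrinsicCylinder_iff one_pos).2 (by simp)⟩) hS hcost
  have hsupp : μ.support ⊆ K := fun x hx => by
    by_contra hxK
    exact ((Measure.mem_support_iff_forall x).1 hx _ (hK.isClosed.isOpen_compl.mem_nhds hxK)).ne'
      hμK
  refine ⟨μ, hμ, hμ0, ?_, fun z₀ r hr => hμU ⟨(z₀, r), hr⟩⟩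
  rw [CompactlyContained, Measure.isClosed_support.closure_eq]
  exact ⟨hK.of_isClosed_subset Measure.isClosed_support hsupp, hsupp.trans hKE⟩
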